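/- Let $A$ be a finite dimensional basic algebra over an algebraically closed field $k$, and let $\{e_1,\dots,e_n\}$ be a complete set of primitive orthogonal idempotents of $A$. Let $Q_A$ be the ordinary quiver of $A$: its vertices are $1,\dots,n$, and the number of arrows from $i$ to $j$ is $\dim_k e_i(\operatorname{rad}A/\operatorname{rad}^2A)e_j$. All modules are finitely generated right $A$-modules. A module $M$ is called sincere if $\operatorname{Hom}_A(P,M)\neq 0$ for every nonzero projective module $P$; it has no self-extensions if $\operatorname{Ext}^1_A(M,M)=0$; it is faithful if $\{a\in A \mid Ma=0\}=0$. The algebra $A$ is called hereditary if every right ideal of $A$ is projective as a right module. Then $A$ is hereditary if and only if $Q_A$ has no loop and every sincere $A$-module with no self-extensions is faithful. -/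

import Mathlib

open CategoryTheory

universe u w

/-! Right `A`-modules are modules over the opposite ring `Aᵐᵒᵖ`; in particular right ideals of `A`
are `Aᵐᵒᵖ`-submodules of `A`. -/

namespace FDAlgebra

/-- A (right) hereditary ring: every right ideal is projective as a right module. -/
def IsHereditary (A : Type u) [Ring A] : Prop :=
  ∀ I : Submodule Aᵐᵒᵖ A, Module.Projective Aᵐᵒᵖ I

/-- A primitive idempotent: a nonzero idempotent that is not a sum of two nonzero orthogonal
idempotents. -/
structure IsPrimitiveIdempotent {A : Type u} [Ring A] (e : A) : Prop where
  idem : IsIdempotentElem e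
  ne_zero : e ≠ 0
  eq_zero_or_eq_zero : ∀ a b : A, IsIdempotentElem a → IsIdempotentElem b →
    a * b = 0 → b * a = 0 → e = a + b → a = 0 ∨ b = 0

/-- A complete set `e₁, …, eₙ` of primitive orthogonal idempotents of `A`:
`1 = e₁ + ⋯ + eₙ`, the `eᵢ` are pairwise orthogonal, and each `eᵢ` is primitive. -/
structure IsCompletePrimitive {A : Type u} [Ring A] {n : ℕ} (e : Fin n → A) : Prop where
  complete : CompleteOrthogonalIdempotents e
  primitive : ∀ i, IsPrimitiveIdempotent (e i)

/-- A basic algebra: it has a complete set `e₁, …, eₙ` of primitive orthogonal idempotents such that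
`eᵢA` and `eⱼA` are not isomorphic as right modules for `i ≠ j`. -/
def IsBasicAlgebra (A : Type u) [Ring A] : Prop :=
  ∃ (n : ℕ) (e : Fin n → A), IsCompletePrimitive e ∧
    ∀ i j, i ≠ j →
      IsEmpty (Submodule.span Aᵐᵒᵖ {e i} ≃ₗ[Aᵐᵒᵖ] Submodule.span Aᵐᵒᵖ {e j})

section Quiver

variable (k : Type w) (A : Type u) [Field k] [Ring A] [Algebra k A]

/-- The Jacobson radical `rad A`, as a `k`-subspace of `A`. -/
def rad : Submodule k A := (Ring.jacobson A).restrictScalars k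

variable {A}

/-- The `k`-vector space `e (rad A / rad² A) f`, as a subspace of `A / rad² A`, where
`rad² A = rad A * rad A` is spanned by the products of two elements of `rad A`. -/
def arrowSpace (e f : A) : Submodule k (A ⧸ (rad k A * rad k A)) :=
  ((rad k A).map (LinearMap.mulLeft k e ∘ₗ LinearMap.mulRight k f)).map
    (rad k A * rad k A).mkQ

/-- The ordinary quiver `Q_A`, computed from a complete set `e₁, …, eₙ` of primitive orthogonal
idempotents: the vertices are `1, …, n`, and there are `dim_k eᵢ (rad A / rad² A) eⱼ` arrows
from `i` to `j`. -/
@[reducible] noncomputable def ordinaryQuiver {n : ℕ} (e : Fin n → A) : Quiver.{0} (Fin n) where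
  Hom i j := Fin (Module.finrank k (arrowSpace k (e i) (e j)))

end Quiver

/-- A quiver has no loop: there is no arrow from a vertex to itself. -/
def HasNoLoop {V : Type*} (Q : Quiver V) : Prop :=
  ∀ v : V, IsEmpty (Q.Hom v v)

section Modules

variable (A : Type u) [Ring A] (M : Type u) [AddCommGroup M] [Module Aᵐᵒᵖ M]

/-- A right module `M` is sincere if `Hom_A(P, M) ≠ 0` for every nonzero finitely generated
projective right module `P`. -/
def IsSincere : Prop :=
  ∀ (P : Type u) [AddCommGroup P] [Module Aᵐᵒᵖ P] [Module.Finite Aᵐᵒᵖ P]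
    [Module.Projective Aᵐᵒᵖ P] [Nontrivial P], ∃ f : P →ₗ[Aᵐᵒᵖ] M, f ≠ 0

/-- A right module `M` is faithful if `{a ∈ A | M a = 0}` vanishes. -/
def IsFaithful : Prop :=
  ∀ a : A, (∀ m : M, MulOpposite.op a • m = 0) → a = 0

/-- A right module `M` has no self-extensions if `Ext¹_A(M, M) = 0`. -/
def HasNoSelfExtensions : Prop :=
  Subsingleton (Abelian.Ext (ModuleCat.of Aᵐᵒᵖ M) (ModuleCat.of Aᵐᵒᵖ M) 1)

end Modules

end FDAlgebra

/-! Suppose `A` is hereditary. A radical endomorphism of an indecomposable projective has projective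
image, so it is zero or injective; being nilpotent it is zero, which excludes loops. If `M` is rigid
with annihilator `I`, then `A/I` embeds in a finite power of `M`, and heredity passes `Ext¹(M, M) =
0` down to `Ext¹(A/I, M) = 0`. Hence every map `I → M` extends to `A`, and so vanishes because `MI =
0`. Since `I` is projective, sincerity forces `I = 0`.

Conversely, for idempotents `f` and `h`, extend copies of `A/AhA` by `fA` along spanning maps `AhA →
fA`. As `Hom(AhA, A/AhA) = 0`, the extension is rigid. When it is sincere, its faithfulness says
that `AhA` is cogenerated by `fA` (`SincereRigidFaithful.exists_hom_ne_zero`). Consequently `eᵢAeⱼ ≠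
0` makes the Loewy length of `eⱼA` at most that of `eᵢA`, with equality only if the two are
isomorphic. Absence of loops then gives `eᵢ (rad A) eᵢ = 0`, so `eᵢ (rad A)` involves only vertices
of smaller Loewy length. By induction on that length, `eᵢ (rad A)` is cogenerated by a sum of
projectives whose submodules are all projective. -/

namespace FDAlgebra

/-! ### Vanishing of `Ext¹`, and modules all of whose submodules are projective. -/

section General

variable {R : Type u} [Ring R]

/-- As `Ext¹(Z, N) = 0`, the long exact sequence identifies `Ext¹(Y, N)` with the cokernel of the
restriction `Hom(Z, N) → Hom(ker π, N)`. -/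
theorem subsingleton_ext_one_iff {Z Y N : Type u} [AddCommGroup Z] [Module R Z] [AddCommGroup Y]
    [Module R Y] [AddCommGroup N] [Module R N] [Module.Projective R Z] (π : Z →ₗ[R] Y)
    (hπ : Function.Surjective π) :
    Subsingleton (Abelian.Ext (ModuleCat.of R Y) (ModuleCat.of R N) 1) ↔
      ∀ θ : LinearMap.ker π →ₗ[R] N, ∃ θ' : Z →ₗ[R] N, ∀ x : LinearMap.ker π, θ' x = θ x := by
  let S : ShortComplex (ModuleCat.{u} R) :=
    ShortComplex.mk (ModuleCat.ofHom (LinearMap.ker π).subtype) (ModuleCat.ofHom π) (by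
      ext x
      exact x.2)
  have hS : S.ShortExact :=
    { exact := by
        rw [ShortComplex.moduleCat_exact_iff]
        intro x hx
        exact ⟨⟨x, hx⟩, rfl⟩
      mono_f := (ModuleCat.mono_iff_injective _).2 (Submodule.subtype_injective _)
      epi_g := (ModuleCat.epi_iff_surjective _).2 hπ }
  have hZ : Projective S.X₂ := by
    have : Module.Projective R S.X₂ := inferInstanceAs (Module.Projective R Z)
    exact (IsProjective.iff_projective S.X₂).1 this
  constructor
  · intro h θ
    have h0 : hS.extClass.comp (Abelian.Ext.mk₀ (ModuleCat.ofHom θ : S.X₁ ⟶ ModuleCat.of R N))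
        (add_zero 1) = 0 := Subsingleton.elim _ _
    obtain ⟨x₂, hx₂⟩ := Abelian.Ext.contravariant_sequence_exact₁ hS _ _ (add_zero 1) h0
    obtain ⟨g, rfl⟩ := (Abelian.Ext.mk₀_bijective _ _).2 x₂
    rw [Abelian.Ext.mk₀_comp_mk₀] at hx₂
    have h1 := (Abelian.Ext.mk₀_bijective _ _).1 hx₂
    exact ⟨g.hom, fun x => congrArg (fun f => f.hom x) h1⟩
  · intro h
    refine subsingleton_of_forall_eq 0 fun x₃ => ?_
    have h0 : (Abelian.Ext.mk₀ S.g).comp x₃ (zero_add 1) = 0 :=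
      Abelian.Ext.eq_zero_of_projective (P := S.X₂) _
    obtain ⟨x₁, hx₁⟩ := Abelian.Ext.contravariant_sequence_exact₃ hS _ x₃ h0 (add_zero 1)
    obtain ⟨g, rfl⟩ := (Abelian.Ext.mk₀_bijective _ _).2 x₁
    obtain ⟨θ', hθ'⟩ := h g.hom
    have hg : g = S.f ≫ (ModuleCat.ofHom θ' : S.X₂ ⟶ ModuleCat.of R N) := by
      ext x
      exact (hθ' x).symm
    rw [← hx₁, hg, ← Abelian.Ext.mk₀_comp_mk₀, ShortComplex.ShortExact.extClass_comp_assoc]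

/-- All submodules are projective. -/
def SubmodulesProjective (R : Type*) [Ring R] (M : Type*) [AddCommGroup M] [Module R M] : Prop :=
  ∀ N : Submodule R M, Module.Projective R N

theorem SubmodulesProjective.of_injective {M N : Type*} [AddCommGroup M] [Module R M]
    [AddCommGroup N] [Module R N] (h : SubmodulesProjective R N) (f : M →ₗ[R] N)
    (hf : Function.Injective f) : SubmodulesProjective R M := fun K =>
  have := h (K.map f)
  Module.Projective.of_equiv (Submodule.equivMapOfInjective f hf K).symm

/-- The image of `K` in `M` is projective, so `K` splits as that image plus `K ∩ N`. -/
theorem SubmodulesProjective.prod {M N : Type*} [AddCommGroup M] [Module R M]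
    [AddCommGroup N] [Module R N] (hM : SubmodulesProjective R M) (hN : SubmodulesProjective R N) :
    SubmodulesProjective R (M × N) := by
  intro K
  let f : K →ₗ[R] M := LinearMap.fst R M N ∘ₗ K.subtype
  have := hM (LinearMap.range f)
  obtain ⟨s, hs⟩ := Module.projective_lifting_property f.rangeRestrict LinearMap.id
    f.surjective_rangeRestrict
  let g : LinearMap.ker f →ₗ[R] N := LinearMap.snd R M N ∘ₗ K.subtype ∘ₗ (LinearMap.ker f).subtype
  have hg : Function.Injective g := by
    intro x y hxy
    have hx : (x : K).1.1 = 0 := x.2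
    have hy : (y : K).1.1 = 0 := y.2
    exact Subtype.ext (Subtype.ext (Prod.ext (hx.trans hy.symm) hxy))
  have h2 : Module.Projective R (LinearMap.ker f) :=
    have := SubmodulesProjective.of_injective (M := LinearMap.ker f) hN g hg ⊤
    Module.Projective.of_equiv Submodule.topEquiv
  have hs' : ∀ y, f.rangeRestrict (s y) = y := fun y => LinearMap.congr_fun hs y
  refine Module.Projective.of_split (M := LinearMap.ker f × LinearMap.range f)
    ((LinearMap.codRestrict (LinearMap.ker f) (LinearMap.id - s ∘ₗ f.rangeRestrict) fun x => ?_).prod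
      f.rangeRestrict) ((LinearMap.ker f).subtype.coprod s) ?_
  · have := congrArg Subtype.val (hs' (f.rangeRestrict x))
    simpa [sub_eq_zero] using this.symm
  · ext x : 1
    simp

theorem SubmodulesProjective.pi {n : ℕ} {M : Fin n → Type*} [∀ i, AddCommGroup (M i)]
    [∀ i, Module R (M i)] (h : ∀ i, SubmodulesProjective R (M i)) :
    SubmodulesProjective R (∀ i, M i) := by
  induction n with
  | zero => exact fun N => inferInstance
  | succ n ih =>
    exact ((h 0).prod (ih fun i => h i.succ)).of_injective
      (Fin.consLinearEquiv R M).symm.toLinearMap (Fin.consLinearEquiv R M).symm.injective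

theorem SubmodulesProjective.pi_of_finite {ι : Type*} [Finite ι] {M : ι → Type*}
    [∀ i, AddCommGroup (M i)] [∀ i, Module R (M i)] (h : ∀ i, SubmodulesProjective R (M i)) :
    SubmodulesProjective R (∀ i, M i) := by
  obtain ⟨n, ⟨σ⟩⟩ := Finite.exists_equiv_fin ι
  refine (SubmodulesProjective.pi fun j : Fin n => h (σ.symm j)).of_injective
    (LinearMap.pi fun j => LinearMap.proj (σ.symm j)) fun x y hxy => funext fun i => ?_
  obtain ⟨j, rfl⟩ := σ.symm.surjective i
  exact congrFun hxy j

/-- Over an Artinian module, a family of maps with trivial common kernel has a finite subfamily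
with trivial common kernel. -/
theorem exists_finset_ker {M : Type*} [AddCommGroup M] [Module R M] [IsArtinian R M]
    {ι : Type*} {N : Type*} [AddCommGroup N] [Module R N] (f : ι → M →ₗ[R] N) :
    ∃ t : Finset ι, ∀ x, (∀ i ∈ t, f i x = 0) → ∀ i, f i x = 0 := by
  obtain ⟨t, ht⟩ := Finset.exists_inf_le fun i => LinearMap.ker (f i)
  refine ⟨t, fun x hx i => ht i ?_⟩
  simpa [Submodule.mem_finsetInf] using hx

/-- By the descending chain condition finitely many maps already separate points, so `M` embeds in a
finite power of `N`. -/
theorem SubmodulesProjective.of_separating {M N : Type*} [AddCommGroup M] [Module R M]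
    [IsArtinian R M] [AddCommGroup N] [Module R N] (hN : SubmodulesProjective R N)
    (h : ∀ x : M, x ≠ 0 → ∃ f : M →ₗ[R] N, f x ≠ 0) : SubmodulesProjective R M := by
  obtain ⟨t, ht⟩ := exists_finset_ker fun f : M →ₗ[R] N => f
  refine (SubmodulesProjective.pi_of_finite fun _ : t => hN).of_injective (LinearMap.pi fun i => i.1) ?_
  rw [← LinearMap.ker_eq_bot, LinearMap.ker_eq_bot']
  intro x hx
  by_contra hne
  obtain ⟨f, hf⟩ := h x hne
  exact hf (ht x (fun i hi => congrFun hx ⟨i, hi⟩) f)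

end General

/-! ### Universal extensions as pushouts. -/

section UniversalExtension

variable {R : Type u} [Ring R] {F P : Type u} [AddCommGroup F] [Module R F] [AddCommGroup P]
  [Module R P] {K : Submodule R F} {ι : Type} [Fintype ι] (φ : ι → K →ₗ[R] P)

/-- The map `K^ι → P × F^ι` whose cokernel is the pushout of `K^ι ⊆ F^ι` along `φ`. -/
def pushoutRel : (ι → K) →ₗ[R] P × (ι → F) :=
  (∑ i, φ i ∘ₗ LinearMap.proj i).prod (LinearMap.pi fun i => -(K.subtype ∘ₗ LinearMap.proj i))

theorem pushoutRel_apply (x : ι → K) : pushoutRel φ x = (∑ i, φ i (x i), fun i => -(x i : F)) := by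
  ext <;> simp [pushoutRel]

/-- The pushout of the inclusion `K^ι ⊆ F^ι` along `φ`: an extension of `(F/K)^ι` by `P`. -/
abbrev UniversalExtension : Type u := (P × (ι → F)) ⧸ LinearMap.range (pushoutRel φ)

namespace UniversalExtension

/-- The inclusion of `P` into the extension. -/
def inl : P →ₗ[R] UniversalExtension φ :=
  (LinearMap.range (pushoutRel φ)).mkQ ∘ₗ LinearMap.inl R P (ι → F)

/-- The map from the `i`-th copy of `F` to the extension. -/
def inr [DecidableEq ι] (i : ι) : F →ₗ[R] UniversalExtension φ :=
  (LinearMap.range (pushoutRel φ)).mkQ ∘ₗ LinearMap.inr R P (ι → F) ∘ₗ LinearMap.single R (fun _ => F) i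

theorem inl_injective : Function.Injective (inl φ) := by
  rw [← LinearMap.ker_eq_bot, LinearMap.ker_eq_bot']
  intro p hp
  obtain ⟨x, hx⟩ := (Submodule.Quotient.mk_eq_zero (LinearMap.range (pushoutRel φ))).1 hp
  rw [pushoutRel_apply] at hx
  have h2 : ∀ i, x i = 0 := fun i => by
    have := congrFun (congrArg Prod.snd hx) i
    simpa using this
  have h1 := congrArg Prod.fst hx
  simpa [h2] using h1.symm

theorem inr_coe [DecidableEq ι] (i : ι) (x : K) : inr φ i x = inl φ (φ i x) := by
  refine (Submodule.Quotient.eq (LinearMap.range (pushoutRel φ))).2 ⟨-Pi.single i x, ?_⟩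
  rw [map_neg, pushoutRel_apply, Finset.sum_eq_single i]
  · ext j
    · simp
    · by_cases h : j = i
      · subst h; simp
      · simp [h]
  · intro j _ hj
    simp [hj]
  · simp

/-- When `φ i = 0` this embeds `F/K` in the extension. -/
theorem inr_eq_zero_iff [DecidableEq ι] (i : ι) (a : F) :
    inr φ i a = 0 ↔ ∃ h : a ∈ K, φ i ⟨a, h⟩ = 0 := by
  constructor
  · intro h
    obtain ⟨x, hx⟩ := (Submodule.Quotient.mk_eq_zero (LinearMap.range (pushoutRel φ))).1 h
    have h2 : a = -(x i : F) := by
      have := congrFun (congrArg Prod.snd hx) i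
      simpa [pushoutRel_apply] using this.symm
    have ha : a ∈ K := h2 ▸ K.neg_mem (x i).2
    refine ⟨ha, inl_injective φ ?_⟩
    rw [map_zero, ← inr_coe, ← h]
  · rintro ⟨h, h0⟩
    rw [show a = ((⟨a, h⟩ : K) : F) from rfl, inr_coe, h0, map_zero]

/-- The projection of the extension onto `(F/K)^ι`. -/
def proj : UniversalExtension φ →ₗ[R] (ι → F ⧸ K) :=
  (LinearMap.range (pushoutRel φ)).liftQ
    (LinearMap.pi fun i => K.mkQ ∘ₗ LinearMap.proj i ∘ₗ LinearMap.snd R P (ι → F)) (by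
      rintro _ ⟨x, rfl⟩
      rw [pushoutRel_apply, LinearMap.mem_ker]
      ext i
      simp)

theorem ker_proj_le : LinearMap.ker (proj φ) ≤ LinearMap.range (inl φ) := by
  intro z hz
  obtain ⟨⟨p, a⟩, rfl⟩ := Submodule.mkQ_surjective _ z
  have ha : ∀ i, a i ∈ K := fun i =>
    (Submodule.Quotient.mk_eq_zero K).1 (congrFun hz i)
  refine ⟨p + ∑ i, φ i ⟨a i, ha i⟩, ?_⟩
  refine (Submodule.Quotient.eq (LinearMap.range (pushoutRel φ))).2 ⟨fun i => ⟨a i, ha i⟩, ?_⟩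
  rw [pushoutRel_apply]
  ext <;> simp

/-- If `Hom(K, F/K) = 0` and the `φ i` span `Hom(K, P)` up to endomorphisms of `(F, K)`, then every
map from `K` to the extension extends to `F`. -/
theorem exists_extend [DecidableEq ι] (h0 : ∀ θ : K →ₗ[R] F ⧸ K, θ = 0)
    (hφ : ∀ ψ : K →ₗ[R] P, ∃ c : ι → F →ₗ[R] F, ∃ hc : ∀ i, ∀ x ∈ K, c i x ∈ K,
      ∀ x : K, ψ x = ∑ i, φ i ⟨c i x, hc i x x.2⟩) (θ : K →ₗ[R] UniversalExtension φ) :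
    ∃ θ' : F →ₗ[R] UniversalExtension φ, ∀ x : K, θ' x = θ x := by
  -- The composite to `(F/K)^ι` vanishes, so `θ` lands in `P`.
  have h1 : ∀ x, θ x ∈ LinearMap.range (inl φ) := fun x => ker_proj_le φ <| by
    rw [LinearMap.mem_ker]
    ext i
    exact LinearMap.congr_fun (h0 (LinearMap.proj i ∘ₗ proj φ ∘ₗ θ)) x
  let ψ : K →ₗ[R] P := (LinearEquiv.ofInjective (inl φ) (inl_injective φ)).symm.toLinearMap ∘ₗ
    θ.codRestrict _ h1
  have hψ : ∀ x, inl φ (ψ x) = θ x := fun x =>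
    congrArg Subtype.val
      ((LinearEquiv.ofInjective (inl φ) (inl_injective φ)).apply_symm_apply ⟨θ x, h1 x⟩)
  obtain ⟨c, hc, hcψ⟩ := hφ ψ
  -- In the pushout each `φ i` becomes the restriction of `inr φ i`.
  refine ⟨∑ i, inr φ i ∘ₗ c i, fun x => ?_⟩
  rw [← hψ, hcψ, map_sum, LinearMap.sum_apply]
  refine Finset.sum_congr rfl fun i _ => ?_
  rw [← inr_coe]
  rfl

/-- `K^ι → P × F^ι` presents the extension with projective middle term, so extending maps from a
single `K` to `F` suffices. -/
theorem subsingleton_ext [DecidableEq ι] [Module.Projective R F] [Module.Projective R P]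
    {N : Type u} [AddCommGroup N] [Module R N]
    (h : ∀ θ : K →ₗ[R] N, ∃ θ' : F →ₗ[R] N, ∀ x : K, θ' x = θ x) :
    Subsingleton (Abelian.Ext (ModuleCat.of R (UniversalExtension φ)) (ModuleCat.of R N) 1) := by
  have : Module.Projective R (ι → F) :=
    Module.Projective.of_equiv (DFinsupp.linearEquivFunOnFintype (R := R) (M := fun _ : ι => F))
  rw [subsingleton_ext_one_iff _ (Submodule.mkQ_surjective (LinearMap.range (pushoutRel φ)))]
  intro θ
  have hmem : ∀ x, pushoutRel φ x ∈ LinearMap.ker (LinearMap.range (pushoutRel φ)).mkQ :=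
    fun x => by rw [Submodule.ker_mkQ]; exact ⟨x, rfl⟩
  choose θ' hθ' using fun i => h (θ ∘ₗ (pushoutRel φ).codRestrict _ hmem ∘ₗ LinearMap.single R (fun _ => K) i)
  -- The sign cancels the one in the second component of `pushoutRel`.
  refine ⟨-∑ i, θ' i ∘ₗ LinearMap.proj i ∘ₗ LinearMap.snd R P (ι → F), ?_⟩
  rintro ⟨z, hz⟩
  obtain ⟨x, rfl⟩ : z ∈ LinearMap.range (pushoutRel φ) := by rwa [Submodule.ker_mkQ] at hz
  have hx : (⟨pushoutRel φ x, hz⟩ : LinearMap.ker (LinearMap.range (pushoutRel φ)).mkQ) =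
      (pushoutRel φ).codRestrict _ hmem (∑ i, Pi.single i (x i)) := by
    rw [Finset.univ_sum_single]
    rfl
  have key : θ ⟨pushoutRel φ x, hz⟩ = ∑ i, θ' i (x i) := by
    rw [hx, map_sum, map_sum]
    exact Finset.sum_congr rfl fun i _ => (hθ' i (x i)).symm
  rw [key]
  simp [pushoutRel_apply]

end UniversalExtension

end UniversalExtension

/-! ### Right ideals `eA` and the ideals `AhA`. -/

section RightIdeals

variable {A : Type u} [Ring A]

instance : Module.Free Aᵐᵒᵖ A :=
  Module.Free.of_equiv (show Aᵐᵒᵖ ≃ₗ[Aᵐᵒᵖ] A from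
    { toFun := MulOpposite.unop
      invFun := MulOpposite.op
      map_add' := fun _ _ => rfl
      map_smul' := fun _ _ => rfl
      left_inv := fun _ => rfl
      right_inv := fun _ => rfl })

/-- Left multiplication by `a`, as an endomorphism of the right module `A`. -/
def leftMul (a : A) : A →ₗ[Aᵐᵒᵖ] A where
  toFun x := a * x
  map_add' := mul_add a
  map_smul' r x := (mul_assoc a x r.unop).symm

@[simp] theorem leftMul_apply (a x : A) : leftMul a x = a * x := rfl

/-- The map from `A` to a right module sending `1` to `m`. -/
def actOn {M : Type*} [AddCommGroup M] [Module Aᵐᵒᵖ M] (m : M) : A →ₗ[Aᵐᵒᵖ] M where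
  toFun x := MulOpposite.op x • m
  map_add' x y := by rw [MulOpposite.op_add, add_smul]
  map_smul' r x := by
    rw [RingHom.id_apply, ← mul_smul]
    rfl

theorem mul_mem_right (I : Submodule Aᵐᵒᵖ A) {x : A} (hx : x ∈ I) (b : A) : x * b ∈ I :=
  I.smul_mem (MulOpposite.op b) hx

theorem map_mul_right {M : Submodule Aᵐᵒᵖ A} {N : Type*} [AddCommGroup N] [Module Aᵐᵒᵖ N]
    (f : M →ₗ[Aᵐᵒᵖ] N) (x : M) (b : A) :
    f ⟨x * b, mul_mem_right M x.2 b⟩ = MulOpposite.op b • f x :=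
  f.map_smul (MulOpposite.op b) x

/-- The right ideal `eA`. -/
def rightIdeal (e : A) : Submodule Aᵐᵒᵖ A := LinearMap.range (leftMul e)

theorem mem_rightIdeal {e x : A} (he : IsIdempotentElem e) : x ∈ rightIdeal e ↔ e * x = x := by
  constructor
  · rintro ⟨y, rfl⟩
    rw [leftMul_apply, ← mul_assoc, he.eq]
  · exact fun h => ⟨x, h⟩

theorem mul_mem_rightIdeal (e x : A) : e * x ∈ rightIdeal e := ⟨x, rfl⟩

theorem projective_rightIdeal {e : A} (he : IsIdempotentElem e) :
    Module.Projective Aᵐᵒᵖ (rightIdeal e) := by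
  refine Module.Projective.of_split (rightIdeal e).subtype (leftMul e).rangeRestrict ?_
  ext x
  exact (mem_rightIdeal he).1 x.2

/-- The two-sided ideal `AhA`, as a right ideal. -/
def idealGenerated (h : A) : Submodule Aᵐᵒᵖ A :=
  Submodule.span Aᵐᵒᵖ (Set.range fun a => a * h)

theorem mul_mul_mem_idealGenerated (a h b : A) : a * h * b ∈ idealGenerated h :=
  mul_mem_right _ (Submodule.subset_span (Set.mem_range_self a)) b

theorem mul_mem_idealGenerated {h x : A} (hx : x ∈ idealGenerated h) (c : A) :
    c * x ∈ idealGenerated h := by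
  have : (idealGenerated h) ≤ (idealGenerated h).comap (leftMul c) := by
    refine Submodule.span_le.2 ?_
    rintro _ ⟨a, rfl⟩
    simpa [mul_assoc] using mul_mul_mem_idealGenerated (c * a) h 1
  exact this hx

/-- A map from `AhA` to a module which kills every `a h` vanishes. -/
theorem hom_idealGenerated_ext {h : A} {M : Type*} [AddCommGroup M] [Module Aᵐᵒᵖ M]
    {f g : idealGenerated h →ₗ[Aᵐᵒᵖ] M}
    (H : ∀ x (hx : x ∈ idealGenerated h), x * h = x → f ⟨x, hx⟩ = g ⟨x, hx⟩)
    (hh : IsIdempotentElem h) : f = g := by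
  ext ⟨x, hx⟩
  refine Submodule.span_induction (p := fun x hx => f ⟨x, hx⟩ = g ⟨x, hx⟩) ?_ ?_ ?_ ?_ hx
  · rintro _ ⟨a, rfl⟩
    exact H _ _ (by rw [mul_assoc, hh.eq])
  · exact (map_zero f).trans (map_zero g).symm
  · intro x y hx hy h1 h2
    exact (map_add f ⟨x, hx⟩ ⟨y, hy⟩).trans
      ((congrArg₂ (· + ·) h1 h2).trans (map_add g ⟨x, hx⟩ ⟨y, hy⟩).symm)
  · intro r x hx h1
    exact (map_smul f r ⟨x, hx⟩).trans
      ((congrArg (r • ·) h1).trans (map_smul g r ⟨x, hx⟩).symm)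

/-- The elements `x = xh` generate `AhA`, and they map into `(A/AhA)h = 0`. -/
theorem hom_quotient_idealGenerated_eq_zero {h : A} (hh : IsIdempotentElem h)
    (θ : idealGenerated h →ₗ[Aᵐᵒᵖ] A ⧸ idealGenerated h) : θ = 0 := by
  refine hom_idealGenerated_ext (fun x hx hxh => ?_) hh
  obtain ⟨c, hc⟩ := Submodule.mkQ_surjective _ (θ ⟨x, hx⟩)
  have h1 : θ ⟨x, hx⟩ = MulOpposite.op h • θ ⟨x, hx⟩ := by
    rw [← map_mul_right θ ⟨x, hx⟩ h]
    simp only [hxh]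
  rw [h1, ← hc]
  refine (Submodule.Quotient.mk_eq_zero _).2 ?_
  simpa using mul_mul_mem_idealGenerated c h 1

end RightIdeals

/-! ### The radical and primitive idempotents. -/

section Radical

variable {k : Type w} {A : Type u} [Field k] [Ring A] [Algebra k A]

theorem mem_rad {x : A} : x ∈ rad k A ↔ x ∈ Ring.jacobson A := Iff.rfl

theorem mul_mem_rad_left {x : A} (hx : x ∈ rad k A) (c : A) : c * x ∈ rad k A :=
  Ideal.mul_mem_left (Ring.jacobson A) c hx

theorem mul_mem_rad_right {x : A} (hx : x ∈ rad k A) (c : A) : x * c ∈ rad k A :=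
  Ideal.mul_mem_right c (Ring.jacobson A) hx

theorem mul_mem_rad_pow_left {t : ℕ} {x : A} (hx : x ∈ rad k A ^ (t + 1)) (c : A) :
    c * x ∈ rad k A ^ (t + 1) := by
  rw [pow_succ'] at hx ⊢
  induction hx using Submodule.mul_induction_on' with
  | mem_mul_mem a ha b hb =>
    rw [← mul_assoc]
    exact Submodule.mul_mem_mul (mul_mem_rad_left ha c) hb
  | add x _ y _ hx hy =>
    rw [mul_add]
    exact add_mem hx hy

theorem mem_rad_of_isNilpotent {x : A} (hx : ∀ y, IsNilpotent (x * y)) : x ∈ rad k A := by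
  rw [mem_rad, ← Ideal.jacobson_bot, Ideal.mem_jacobson_iff]
  intro y
  obtain ⟨n, hn⟩ := hx y
  have h1 : IsNilpotent (y * x) := ⟨n + 1, by
    have : ∀ n : ℕ, (y * x) ^ (n + 1) = y * (x * y) ^ n * x := by
      intro n
      induction n with
      | zero => simp
      | succ n ih => rw [pow_succ, ih, pow_succ]; simp only [mul_assoc]
    rw [this, hn, mul_zero, zero_mul]⟩
  obtain ⟨u, hu⟩ := h1.isUnit_add_one
  refine ⟨↑u⁻¹, ?_⟩
  have : (↑u⁻¹ : A) * (y * x + 1) = 1 := by rw [← hu, Units.inv_mul]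
  rw [Ideal.mem_bot, mul_assoc, ← mul_add_one, this, sub_self]

variable [FiniteDimensional k A]

variable (k A) in
theorem exists_rad_pow_eq_bot : ∃ n : ℕ, rad k A ^ n = ⊥ := by
  have : IsArtinianRing A := isArtinian_of_tower k inferInstance
  obtain ⟨n, hn⟩ := IsSemiprimaryRing.isNilpotent (R := A)
  have key : ∀ n : ℕ, ∀ x ∈ rad k A ^ (n + 1), x ∈ Ring.jacobson A ^ (n + 1) := by
    intro n
    induction n with
    | zero =>
      intro x hx
      rw [zero_add, Submodule.pow_one] at hx ⊢
      exact hx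
    | succ n ih =>
      intro x hx
      rw [Submodule.pow_succ] at hx ⊢
      exact Submodule.mul_induction_on hx (fun a ha b hb => Ideal.mul_mem_mul (ih a ha) hb)
        fun a b ha hb => add_mem ha hb
  refine ⟨n + 1, (Submodule.eq_bot_iff _).2 fun x hx => ?_⟩
  have := key n x hx
  rw [Submodule.pow_succ, hn, Submodule.zero_eq_bot, Submodule.bot_mul] at this
  exact this

theorem isNilpotent_of_mem_rad {x : A} (hx : x ∈ rad k A) : IsNilpotent x := by
  obtain ⟨n, hn⟩ := exists_rad_pow_eq_bot k A
  exact ⟨n, (Submodule.mem_bot k).1 (hn ▸ Submodule.pow_mem_pow _ hx n)⟩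

open scoped IsMulCommutative in
/-- Fitting's lemma in the corner ring of a primitive idempotent. -/
theorem IsPrimitiveIdempotent.isNilpotent_or_exists_mul_eq (k : Type w) {A : Type u} [Field k]
    [Ring A] [Algebra k A] [FiniteDimensional k A] {e : A} (he : IsPrimitiveIdempotent e) {a : A}
    (h1 : e * a = a) (h2 : a * e = a) : IsNilpotent a ∨ ∃ b, a * b = e := by
  let S := Algebra.adjoin k {a}
  have : IsArtinianRing S := isArtinian_of_tower k inferInstance
  let α : S := ⟨a, Algebra.self_mem_adjoin_singleton k a⟩
  -- The powers of `a` stabilise in the commutative Artinian ring `k[a]`.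
  obtain ⟨n, y, hy⟩ := IsArtinian.exists_pow_succ_smul_dvd α (1 : S)
  simp only [smul_eq_mul, mul_one] at hy
  have hpow : ∀ m : ℕ, α ^ (n + m) * y ^ m = α ^ n := by
    intro m
    induction m with
    | zero => simp
    | succ m ih => 
      rw [← ih, show n + (m + 1) = n.succ + m by omega, pow_succ, pow_add, pow_add α n m]
      rw [← hy]
      ring
  have hz := hpow (n + 1)
  let z : A := (y ^ (n + 1) : S)
  have hza : Commute z a := congrArg Subtype.val (mul_comm (y ^ (n + 1)) α)
  have hz : a ^ (n + (n + 1)) * z = a ^ n := congrArg Subtype.val hz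
  -- The Fitting idempotent. The exponent `n + 1` keeps it in `eAe` even when `n = 0`.
  let f : A := a ^ (n + 1) * z
  have hef : e * f = f := by simp only [f]; rw [pow_succ', ← mul_assoc, ← mul_assoc, h1]
  have hfe : f * e = f := by
    simp only [f]
    rw [(hza.pow_right _).symm.eq, pow_succ, mul_assoc, mul_assoc, h2]
  have hff : f * f = f := by
    have : a ^ (n + (n + 1)) * a = a ^ (n + 1) * a ^ (n + 1) := by
      rw [← pow_succ, ← pow_add]; congr 1; omega
    simp only [f]
    rw [mul_assoc, ← mul_assoc z, (hza.pow_right (n + 1)).eq, mul_assoc, ← mul_assoc (a ^ (n + 1)),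
      ← this, mul_assoc _ a, ← mul_assoc a, ← hza.eq, mul_assoc z a z, ← mul_assoc _ z, hz,
      ← mul_assoc, pow_succ]
  have h3 := he.eq_zero_or_eq_zero f (e - f) hff (by
      change (e - f) * (e - f) = e - f
      rw [mul_sub, sub_mul, sub_mul, he.idem.eq, hef, hfe, hff, sub_self, sub_zero])
    (by rw [mul_sub, hff, hfe, sub_self]) (by rw [sub_mul, hef, hff, sub_self]) (by abel)
  obtain h3 | h3 := h3
  · refine Or.inl ⟨n, ?_⟩
    rw [← hz, pow_add, mul_assoc]
    exact (congrArg (a ^ n * ·) h3).trans (mul_zero _)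
  · refine Or.inr ⟨a ^ n * z, ?_⟩
    rw [← mul_assoc, ← pow_succ']
    exact (sub_eq_zero.1 h3).symm

/-- `eA` is local: an element outside the radical generates it. Fitting's lemma is applied to each
`xye`, which is nilpotent exactly when `xy` is. -/
theorem IsPrimitiveIdempotent.mem_rad_or_exists_mul_eq {e : A} (he : IsPrimitiveIdempotent e)
    {x : A} (hx : e * x = x) : x ∈ rad k A ∨ ∃ b, x * b = e := by
  by_cases h : ∃ b, x * b = e
  · exact Or.inr h
  refine Or.inl (mem_rad_of_isNilpotent fun y => ?_)
  obtain ⟨n, hn⟩ | ⟨b, hb⟩ := he.isNilpotent_or_exists_mul_eq k (a := x * y * e)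
    (by rw [← mul_assoc, ← mul_assoc, hx]) (by rw [mul_assoc, he.idem.eq])
  · refine ⟨n + 1, ?_⟩
    have h3 : ∀ n : ℕ, (x * y * e) ^ n * (x * y) = (x * y) ^ (n + 1) := by
      intro n
      induction n with
      | zero => simp
      | succ n ih =>
        rw [pow_succ', mul_assoc, ih, pow_succ' _ n, pow_succ', pow_succ']
        simp only [mul_assoc]
        rw [← mul_assoc e, hx]
    rw [← h3, hn, zero_mul]
  · exact (h ⟨y * e * b, by simpa only [mul_assoc] using hb⟩).elim

end Radical

theorem UniversalExtension.exists_eq_add_sum {R : Type u} [Ring R] {F P : Type u} [AddCommGroup F]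
    [Module R F] [AddCommGroup P] [Module R P] {K : Submodule R F} {ι : Type} [Fintype ι]
    [DecidableEq ι] (φ : ι → K →ₗ[R] P) (z : UniversalExtension φ) :
    ∃ (p : P) (x : ι → F), z = inl φ p + ∑ i, inr φ i (x i) := by
  obtain ⟨⟨p, x⟩, rfl⟩ := Submodule.mkQ_surjective _ z
  refine ⟨p, x, ?_⟩
  have : (p, x) = LinearMap.inl R P (ι → F) p +
      ∑ i, LinearMap.inr R P (ι → F) (LinearMap.single R (fun _ => F) i (x i)) := by
    rw [← map_sum]
    ext j <;> simp [Finset.univ_sum_single]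
  rw [this, map_add, map_sum]
  rfl

/-! ### Testing sincerity, and faithfulness of universal extensions. -/

section SincereModules

variable {k : Type w} {A : Type u} [Field k] [Ring A] [Algebra k A] [FiniteDimensional k A]

/-- Otherwise, expanding in a dual basis repeatedly puts every value of every functional in all
powers of the nilpotent radical, so all coordinates vanish. -/
theorem Projective.exists_apply_notMem_rad (k : Type w) {A : Type u} [Field k] [Ring A]
    [Algebra k A] [FiniteDimensional k A] (Q : Type u) [AddCommGroup Q] [Module Aᵐᵒᵖ Q]
    [Module.Projective Aᵐᵒᵖ Q] [Nontrivial Q] :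
    ∃ (f : Q →ₗ[Aᵐᵒᵖ] A) (q : Q), f q ∉ rad k A := by
  by_contra! H
  obtain ⟨s, hs⟩ := (inferInstance : Module.Projective Aᵐᵒᵖ Q)
  let c (j : Q) : Q →ₗ[Aᵐᵒᵖ] A := actOn (1 : A) ∘ₗ
    (show Aᵐᵒᵖ →ₗ[Aᵐᵒᵖ] A from
      { toFun := MulOpposite.unop
        map_add' := fun _ _ => rfl
        map_smul' := fun _ _ => rfl }) ∘ₗ Finsupp.lapply j ∘ₗ s
  have hc : ∀ j q, c j q = (s q j).unop := fun j q => one_mul _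
  have hq : ∀ q, q = ∑ j ∈ (s q).support, MulOpposite.op (c j q) • j := by
    intro q
    conv_lhs => rw [← hs q, Finsupp.linearCombination_apply]
    exact Finset.sum_congr rfl fun j _ => by rw [hc]; rfl
  have key : ∀ (t : ℕ) (f : Q →ₗ[Aᵐᵒᵖ] A) (q : Q), f q ∈ rad k A ^ (t + 1) := by
    intro t
    induction t with
    | zero =>
      intro f q
      rw [zero_add, pow_one]
      exact H f q
    | succ t ih =>
      intro f q
      rw [hq q, map_sum, pow_succ]
      refine Submodule.sum_mem _ fun j _ => ?_
      rw [map_smul]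
      exact Submodule.mul_mem_mul (ih f j) (H (c j) q)
  obtain ⟨n, hn⟩ := exists_rad_pow_eq_bot k A
  obtain ⟨q, hq0⟩ := exists_ne (0 : Q)
  refine hq0 ?_
  rw [hq q]
  refine Finset.sum_eq_zero fun j _ => ?_
  have := key n (c j) q
  rw [pow_succ, hn, Submodule.bot_mul, Submodule.mem_bot] at this
  rw [this, MulOpposite.op_zero, zero_smul]

theorem IsCompletePrimitive.sum_mul {A : Type u} [Ring A] {n : ℕ} {e : Fin n → A}
    (he : IsCompletePrimitive e) (x : A) : ∑ i, e i * x = x := by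
  rw [← Finset.sum_mul, he.complete.complete, one_mul]

theorem IsCompletePrimitive.sum_mul' {A : Type u} [Ring A] {n : ℕ} {e : Fin n → A}
    (he : IsCompletePrimitive e) (x : A) : ∑ i, x * e i = x := by
  rw [← Finset.mul_sum, he.complete.complete, mul_one]

include k in
-- Every nonzero projective maps onto some `eᵢA`, which maps nontrivially to `M` when `Meᵢ ≠ 0`.
theorem IsCompletePrimitive.isSincere {n : ℕ} {e : Fin n → A} (he : IsCompletePrimitive e)
    {M : Type u} [AddCommGroup M] [Module Aᵐᵒᵖ M]
    (hM : ∀ i, ∃ m : M, MulOpposite.op (e i) • m ≠ 0) : IsSincere A M := by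
  intro Q _ _ _ _ _
  obtain ⟨f, q, hq⟩ := Projective.exists_apply_notMem_rad k (A := A) Q
  obtain ⟨i, hi⟩ : ∃ i, e i * f q ∉ rad k A := by
    by_contra! H
    exact hq (he.sum_mul (f q) ▸ Submodule.sum_mem _ fun i _ => H i)
  obtain ⟨b, hb⟩ := ((he.primitive i).mem_rad_or_exists_mul_eq (k := k) (x := e i * f q)
    (by rw [← mul_assoc, (he.primitive i).idem.eq])).resolve_left hi
  obtain ⟨m, hm⟩ := hM i
  refine ⟨actOn m ∘ₗ leftMul (e i) ∘ₗ f, fun h0 => hm ?_⟩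
  have h1 := LinearMap.congr_fun h0 (MulOpposite.op b • q)
  rw [LinearMap.comp_apply, LinearMap.comp_apply, map_smul, leftMul_apply, op_smul_eq_mul,
    ← mul_assoc, hb] at h1
  exact h1

theorem finite_of_submodule (k : Type w) {A : Type u} [Field k] [Ring A]
    [Algebra k A] [FiniteDimensional k A] (K : Submodule Aᵐᵒᵖ A) : Module.Finite k K :=
  Module.Finite.of_injective (K.subtype.restrictScalars k) (Submodule.subtype_injective K)

theorem finite_hom (k : Type w) {A : Type u} [Field k] [Ring A] [Algebra k A]
    [FiniteDimensional k A] (K P : Submodule Aᵐᵒᵖ A) : Module.Finite k (K →ₗ[Aᵐᵒᵖ] P) :=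
  have := finite_of_submodule k K
  have := finite_of_submodule k P
  Module.Finite.of_injective (LinearMap.restrictScalarsₗ k Aᵐᵒᵖ K P k)
    (LinearMap.restrictScalars_injective k)

/-- Every sincere module without self-extensions is faithful. -/
def SincereRigidFaithful (A : Type u) [Ring A] : Prop :=
  ∀ (M : Type u) [AddCommGroup M] [Module Aᵐᵒᵖ M] [Module.Finite Aᵐᵒᵖ M],
    IsSincere A M → HasNoSelfExtensions A M → IsFaithful A M

include k in
/-- The universal extension of copies of `A/AhA` by `fA` has no self-extensions; if it is sincere
and hence faithful, the maps `AhA → fA` separate points. -/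
theorem SincereRigidFaithful.exists_hom_ne_zero (hA : SincereRigidFaithful A) {n : ℕ}
    {e : Fin n → A} (he : IsCompletePrimitive e) {f h : A} (hf : IsIdempotentElem f)
    (hh : IsIdempotentElem h) (hs : ∀ i, (∃ c, f * c * e i ≠ 0) ∨ e i ∉ idealGenerated h) {a : A}
    (ha : a ∈ idealGenerated h) (ha0 : a ≠ 0) :
    ∃ ψ : idealGenerated h →ₗ[Aᵐᵒᵖ] rightIdeal f, ψ ⟨a, ha⟩ ≠ 0 := by
  by_contra! H
  have := finite_hom k (idealGenerated h) (rightIdeal f)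
  have := projective_rightIdeal hf
  have : Module.Finite Aᵐᵒᵖ A := Module.Finite.of_restrictScalars_finite k Aᵐᵒᵖ A
  have : Module.Finite Aᵐᵒᵖ (rightIdeal f) :=
    Module.Finite.of_surjective (leftMul f).rangeRestrict (leftMul f).surjective_rangeRestrict
  obtain ⟨m, s, hsp⟩ := Module.Finite.exists_fin (R := k) (M := idealGenerated h →ₗ[Aᵐᵒᵖ] rightIdeal f)
  -- The extra zero map at `none` provides a direct copy of `A/AhA`, which detects the `eᵢ` outside
  -- `AhA`.
  let φ : Option (Fin m) → idealGenerated h →ₗ[Aᵐᵒᵖ] rightIdeal f := fun i => i.elim 0 s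
  have hrigid : HasNoSelfExtensions A (UniversalExtension φ) := by
    refine UniversalExtension.subsingleton_ext φ fun θ =>
      UniversalExtension.exists_extend φ (hom_quotient_idealGenerated_eq_zero hh) (fun ψ => ?_) θ
    have hψ : ψ ∈ Submodule.span k (Set.range s) := hsp ▸ Submodule.mem_top
    obtain ⟨c, rfl⟩ := (Submodule.mem_span_range_iff_exists_fun k).1 hψ
    -- Scalar coefficients act as endomorphisms of `A` preserving `AhA`.
    refine ⟨fun i => leftMul (algebraMap k A (i.elim 0 c)),
      fun i x hx => mul_mem_idealGenerated hx _, fun x => ?_⟩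
    rw [Fintype.sum_option, LinearMap.sum_apply]
    simp only [φ, Option.elim_none, LinearMap.zero_apply, zero_add, Option.elim_some]
    refine Finset.sum_congr rfl fun i _ => ?_
    have hx : (⟨leftMul (algebraMap k A (c i)) x, mul_mem_idealGenerated x.2 _⟩ : idealGenerated h)
        = c i • x := Subtype.ext (Algebra.smul_def _ _).symm
    rw [hx, LinearMap.map_smul_of_tower, LinearMap.smul_apply]
  have hsin : IsSincere A (UniversalExtension φ) := by
    refine he.isSincere (k := k) fun i => ?_
    obtain ⟨c, hc⟩ | hi := hs i
    · refine ⟨UniversalExtension.inl φ ⟨f * c, mul_mem_rightIdeal f c⟩, fun h0 => hc ?_⟩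
      rw [← map_smul] at h0
      exact congrArg Subtype.val (UniversalExtension.inl_injective φ (h0.trans (map_zero _).symm))
    · refine ⟨UniversalExtension.inr φ none 1, fun h0 => hi ?_⟩
      rw [← map_smul, op_smul_eq_mul, one_mul] at h0
      exact ((UniversalExtension.inr_eq_zero_iff φ none _).1 h0).1
  refine ha0 (hA _ hsin hrigid a fun z => ?_)
  obtain ⟨p, x, rfl⟩ := UniversalExtension.exists_eq_add_sum φ z
  rw [smul_add, Finset.smul_sum, ← map_smul]
  -- Left multiplication by `p` is itself a map `AhA → fA`, so it kills `a`.
  have hp : MulOpposite.op a • p = 0 := by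
    have := H ((leftMul (p : A) ∘ₗ (idealGenerated h).subtype).codRestrict (rightIdeal f)
      fun y => mul_mem_right _ p.2 _)
    exact this
  rw [hp, map_zero, zero_add]
  refine Finset.sum_eq_zero fun i _ => ?_
  rw [← map_smul, op_smul_eq_mul,
    show x i * a = ((⟨x i * a, mul_mem_idealGenerated ha _⟩ : idealGenerated h) : A) from rfl,
    UniversalExtension.inr_coe]
  have := H (φ i ∘ₗ (leftMul (x i)).restrict (p := idealGenerated h) (q := idealGenerated h)
    fun y hy => mul_mem_idealGenerated hy _)
  exact (congrArg _ this).trans (map_zero _)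

end SincereModules

/-! ### Loewy lengths, and heredity from faithfulness. -/

section LoewyLength

variable {k : Type w} {A : Type u} [Field k] [Ring A] [Algebra k A] [FiniteDimensional k A]

section Idempotents

variable {A : Type u} [Ring A] {n : ℕ} {e : Fin n → A}

theorem IsCompletePrimitive.mul_self (he : IsCompletePrimitive e) (i : Fin n) : e i * e i = e i :=
  (he.primitive i).idem.eq

theorem IsCompletePrimitive.mul_sum_eq (he : IsCompletePrimitive e) {S : Finset (Fin n)} {j : Fin n}
    (hj : j ∈ S) : e j * ∑ i ∈ S, e i = e j := by
  rw [Finset.mul_sum, Finset.sum_eq_single_of_mem j hj fun i _ hi => he.complete.ortho hi.symm,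
    he.mul_self]

theorem IsCompletePrimitive.isIdempotentElem_sum (he : IsCompletePrimitive e) (S : Finset (Fin n)) :
    IsIdempotentElem (∑ i ∈ S, e i) := by
  change (∑ i ∈ S, e i) * _ = _
  rw [Finset.sum_mul]
  exact Finset.sum_congr rfl fun i hi => he.mul_sum_eq hi

/-- Elements of `eAf` which are invertible on one side are invertible. -/
theorem IsPrimitiveIdempotent.mul_eq_of_mul_eq {e f x y : A} (he : IsPrimitiveIdempotent e)
    (hf : IsPrimitiveIdempotent f) (hxf : x * f = x) (hfy : f * y = y)
    (hye : y * e = y) (hxy : x * y = e) : y * x = f := by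
  have hi : (y * x) * (y * x) = y * x := by
    rw [mul_assoc, ← mul_assoc x, hxy, ← mul_assoc, hye]
  have h1 : f * (y * x) = y * x := by rw [← mul_assoc, hfy]
  have h2 : y * x * f = y * x := by rw [mul_assoc, hxf]
  obtain h | h := hf.eq_zero_or_eq_zero (y * x) (f - y * x) hi (by
      change (f - y * x) * (f - y * x) = f - y * x
      rw [mul_sub, sub_mul, sub_mul, hf.idem.eq, h1, h2, hi, sub_self, sub_zero])
    (by rw [mul_sub, hi, h2, sub_self]) (by rw [sub_mul, h1, hi, sub_self]) (by abel)
  · refine (he.ne_zero ?_).elim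
    rw [← he.idem.eq, ← hxy, mul_assoc, ← mul_assoc y, h, zero_mul, mul_zero]
  · exact (sub_eq_zero.1 h).symm

end Idempotents

include k in
theorem IsPrimitiveIdempotent.exists_inverse {e f x : A} (he : IsPrimitiveIdempotent e)
    (hf : IsPrimitiveIdempotent f) (hex : e * x = x) (hxf : x * f = x) (hx : x ∉ rad k A) :
    ∃ y, f * y = y ∧ y * e = y ∧ x * y = e ∧ y * x = f := by
  obtain ⟨b, hb⟩ := (he.mem_rad_or_exists_mul_eq (k := k) hex).resolve_left hx
  have h1 : f * (f * b * e) = f * b * e := by rw [← mul_assoc, ← mul_assoc, hf.idem.eq]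
  have h2 : f * b * e * e = f * b * e := by rw [mul_assoc, he.idem.eq]
  have h3 : x * (f * b * e) = e := by rw [← mul_assoc, ← mul_assoc, hxf, hb, he.idem.eq]
  exact ⟨_, h1, h2, h3, he.mul_eq_of_mul_eq hf hxf h1 h2 h3⟩

theorem IsPrimitiveIdempotent.notMem_rad {e : A} (he : IsPrimitiveIdempotent e) : e ∉ rad k A := by
  intro h
  obtain ⟨n, hn⟩ := isNilpotent_of_mem_rad h
  have h1 := he.idem.pow_succ_eq n
  rw [pow_succ, hn, zero_mul] at h1
  exact he.ne_zero h1.symm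

variable {n : ℕ} {e : Fin n → A}

include k in
-- Since `eₗ` is not radical, some `eₗ a eₛ b eₗ` is not either; then `eₗA ≅ eₛA`, which transports
-- nonvanishing from `eₛ` to `eₗ`.
theorem IsCompletePrimitive.exists_of_mem_idealGenerated_sum (he : IsCompletePrimitive e)
    {i l : Fin n} {S : Finset (Fin n)} (hS : ∀ s ∈ S, ∃ c, e i * c * e s ≠ 0)
    (hl : e l ∈ idealGenerated (∑ s ∈ S, e s)) : ∃ c, e i * c * e l ≠ 0 := by
  by_cases H : ∃ s ∈ S, ∃ a b, e l * a * e s * b * e l ∉ rad k A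
  · obtain ⟨s, hs, a, b, hab⟩ := H
    obtain ⟨c, hc⟩ := hS s hs
    have hab' : e l * a * e s ∉ rad k A := fun h => hab <| by
      rw [mul_assoc _ b]
      exact mul_mem_rad_right h _
    obtain ⟨y, -, hyl, -, hyx⟩ := (he.primitive l).exists_inverse (k := k) (he.primitive s)
      (x := e l * a * e s) (by rw [← mul_assoc, ← mul_assoc, he.mul_self])
      (by rw [mul_assoc, he.mul_self]) hab'
    refine ⟨c * y, fun h0 => hc ?_⟩
    rw [mul_assoc, mul_assoc, hyl] at h0
    rw [← hyx, ← mul_assoc (e i * c), mul_assoc (e i), h0, zero_mul]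
  · push Not at H
    have key : ∀ x ∈ idealGenerated (∑ s ∈ S, e s), ∀ b, e l * x * b * e l ∈ rad k A := by
      intro x hx
      induction hx using Submodule.span_induction with
      | mem x hx =>
        obtain ⟨a, rfl⟩ := hx
        intro b
        simp only
        rw [Finset.mul_sum, Finset.mul_sum, Finset.sum_mul, Finset.sum_mul]
        refine Submodule.sum_mem _ fun s hs => ?_
        rw [← mul_assoc]
        exact H s hs a b
      | zero => simp
      | add x y _ _ hx hy =>
        intro b
        rw [mul_add, add_mul, add_mul]
        exact add_mem (hx b) (hy b)
      | smul r x _ hx =>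
        intro b
        have := hx (r.unop * b)
        rwa [← mul_assoc, mul_assoc (e l) x] at this
    have := key _ hl 1
    rw [mul_one, he.mul_self, he.mul_self] at this
    exact ((he.primitive l).notMem_rad this).elim

include k in
/-- If `eᵢAeⱼ ≠ 0` then `eⱼA` is cogenerated by `eᵢA`. -/
theorem SincereRigidFaithful.eq_zero_of_forall_mul_eq_zero (hA : SincereRigidFaithful A)
    (he : IsCompletePrimitive e) {i j : Fin n} (hij : ∃ c, e i * c * e j ≠ 0) {a : A}
    (ha : e j * a = a) (h0 : ∀ c, e i * c * a = 0) : a = 0 := by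
  classical
  by_contra hne
  let S : Finset (Fin n) := {s | ∃ c, e i * c * e s ≠ 0}
  have hmem : ∀ s, s ∈ S ↔ ∃ c, e i * c * e s ≠ 0 := fun s => by simp [S]
  have hj : e j ∈ idealGenerated (∑ s ∈ S, e s) := by
    simpa [he.mul_sum_eq ((hmem j).2 hij)] using mul_mul_mem_idealGenerated (e j) (∑ s ∈ S, e s) 1
  obtain ⟨ψ, hψ⟩ := hA.exists_hom_ne_zero (k := k) he (he.primitive i).idem
    (he.isIdempotentElem_sum S) (fun l => by
      by_cases hl : ∃ c, e i * c * e l ≠ 0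
      · exact Or.inl hl
      · exact Or.inr fun h => hl (he.exists_of_mem_idealGenerated_sum (k := k)
          (fun s hs => (hmem s).1 hs) h))
    (a := a) (ha ▸ mul_mem_right _ hj a) hne
  refine hψ ?_
  have h1 := map_mul_right ψ ⟨e j, hj⟩ a
  simp only [ha] at h1
  rw [h1]
  refine Subtype.ext ?_
  change (ψ ⟨e j, hj⟩ : A) * a = 0
  rw [← (mem_rightIdeal (he.primitive i).idem).1 (ψ ⟨e j, hj⟩).2]
  exact h0 _

variable (k) in
theorem exists_mul_rad_pow_eq_zero (x : A) : ∃ t : ℕ, ∀ y ∈ rad k A ^ (t + 1), x * y = 0 := by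
  obtain ⟨t, ht⟩ := exists_rad_pow_eq_bot k A
  refine ⟨t, fun y hy => ?_⟩
  rw [pow_succ, ht, Submodule.bot_mul, Submodule.mem_bot] at hy
  rw [hy, mul_zero]

variable (k) in
open Classical in
/-- The least `t` such that `x` annihilates `rad^(t+1)`; for an idempotent `x`, one less than the
Loewy length of `xA`. -/
noncomputable def loewy (x : A) : ℕ := Nat.find (exists_mul_rad_pow_eq_zero k x)

theorem mul_eq_zero_of_mem_rad_pow_loewy {x y : A} (hy : y ∈ rad k A ^ (loewy k x + 1)) :
    x * y = 0 := by
  classical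
  exact Nat.find_spec (exists_mul_rad_pow_eq_zero k x) y hy

theorem loewy_le {x : A} {t : ℕ} (h : ∀ y ∈ rad k A ^ (t + 1), x * y = 0) : loewy k x ≤ t := by
  classical
  exact Nat.find_min' (exists_mul_rad_pow_eq_zero k x) h

/-- A radical power killing `eᵢA` kills everything cogenerated by it. -/
theorem SincereRigidFaithful.loewy_le (hA : SincereRigidFaithful A) (he : IsCompletePrimitive e)
    {i j : Fin n} (hij : ∃ c, e i * c * e j ≠ 0) : loewy k (e j) ≤ loewy k (e i) := by
  refine FDAlgebra.loewy_le fun y hy => hA.eq_zero_of_forall_mul_eq_zero (k := k) he hij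
    (by rw [← mul_assoc, he.mul_self]) fun c => ?_
  rw [mul_assoc]
  exact mul_eq_zero_of_mem_rad_pow_loewy (mul_mem_rad_pow_left (mul_mem_rad_pow_left hy _) _)

/-- Here all maps `eⱼA → eᵢA` land in `eᵢ (rad A)`, which is killed by one radical power fewer. -/
theorem SincereRigidFaithful.loewy_lt (hA : SincereRigidFaithful A) (he : IsCompletePrimitive e)
    {i j : Fin n} (hij : ∃ c, e i * c * e j ≠ 0) (hr : ∀ c, e i * c * e j ∈ rad k A) :
    loewy k (e j) < loewy k (e i) := by
  have hmul : ∀ c, e i * (e i * c * e j) = e i * c * e j := fun c => by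
    rw [← mul_assoc, ← mul_assoc, he.mul_self]
  obtain h | h := Nat.eq_zero_or_pos (loewy k (e i))
  · obtain ⟨c, hc⟩ := hij
    refine (hc ?_).elim
    rw [← hmul]
    refine mul_eq_zero_of_mem_rad_pow_loewy (k := k) ?_
    rw [h, zero_add, pow_one]
    exact hr c
  · refine Nat.lt_of_le_pred h (FDAlgebra.loewy_le fun y hy =>
      hA.eq_zero_of_forall_mul_eq_zero (k := k) he hij (by rw [← mul_assoc, he.mul_self])
        fun c => ?_)
    rw [← mul_assoc, ← hmul, mul_assoc]
    refine mul_eq_zero_of_mem_rad_pow_loewy (k := k) ?_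
    rw [Nat.pred_eq_sub_one, Nat.sub_add_cancel h] at hy
    rw [pow_succ']
    exact Submodule.mul_mem_mul (hr c) hy

/-- If `eᵢAeⱼ ≠ 0` and the Loewy lengths agree, then `eᵢA` and `eⱼA` are isomorphic. -/
theorem SincereRigidFaithful.exists_inverse (hA : SincereRigidFaithful A)
    (he : IsCompletePrimitive e) {i j : Fin n} (hij : ∃ c, e i * c * e j ≠ 0)
    (hl : loewy k (e i) ≤ loewy k (e j)) :
    ∃ x y : A, e j * y = y ∧ y * e i = y ∧ e i * x = x ∧ y * x = e j := by
  obtain ⟨c, hc⟩ : ∃ c, e i * c * e j ∉ rad k A := by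
    by_contra! H
    exact (hA.loewy_lt he hij H).not_ge hl
  have h1 : e i * (e i * c * e j) = e i * c * e j := by rw [← mul_assoc, ← mul_assoc, he.mul_self]
  obtain ⟨y, hjy, hyi, -, hyx⟩ := (he.primitive i).exists_inverse (he.primitive j) h1
    (by rw [mul_assoc, he.mul_self]) hc
  exact ⟨_, y, hjy, hyi, h1, hyx⟩

/-- If `eᵢ (rad A) eᵢ` lies in a radical power, then `eᵢ (rad² A) eᵢ` lies in the next; `hi` returns
this to `eᵢ (rad A) eᵢ`, and nilpotency finishes. -/
theorem SincereRigidFaithful.mul_rad_mul_self_eq_zero (hA : SincereRigidFaithful A)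
    (he : IsCompletePrimitive e) {i : Fin n}
    (hi : ∀ x ∈ rad k A, e i * x * e i ∈ rad k A * rad k A) {x : A} (hx : x ∈ rad k A) :
    e i * x * e i = 0 := by
  have key : ∀ t : ℕ, ∀ x ∈ rad k A, e i * x * e i ∈ rad k A ^ (t + 1) := by
    intro t
    induction t with
    | zero =>
      intro x hx
      rw [zero_add, pow_one]
      exact mul_mem_rad_right (mul_mem_rad_left hx _) _
    | succ t ih =>
      intro x hx
      have hsq : ∀ z ∈ rad k A * rad k A, e i * z * e i ∈ rad k A ^ (t + 1 + 1) := by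
        intro z hz
        induction hz using Submodule.mul_induction_on' with
        | mem_mul_mem a ha b hb =>
          rw [← he.sum_mul' a, Finset.sum_mul, Finset.mul_sum, Finset.sum_mul]
          refine Submodule.sum_mem _ fun l _ => ?_
          have hsplit : e i * (a * e l * b) * e i = (e i * a * e l) * (e l * b * e i) := by
            conv_lhs => rw [← he.mul_self l]
            simp only [mul_assoc]
          by_cases h1 : e i * a * e l = 0
          · rw [hsplit, h1, zero_mul]
            exact zero_mem _
          by_cases h2 : e l * b * e i = 0
          · rw [hsplit, h2, mul_zero]
            exact zero_mem _
          -- A nonzero path from `i` through `l` back to `i` forces `eₗA ≅ eᵢA`, so it factors into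
          -- two radical elements of `eᵢAeᵢ`.
          obtain ⟨u, y, -, hyi, hiu, hyu⟩ := hA.exists_inverse (k := k) he ⟨a, h1⟩
            (hA.loewy_le he ⟨b, h2⟩)
          have : e i * (a * e l * b) * e i = (e i * (a * y) * e i) * (e i * (u * b) * e i) := by
            have h3 : (e i * (a * y) * e i) * (e i * (u * b) * e i) =
                e i * (a * ((y * e i) * (e i * u)) * b) * e i := by simp only [mul_assoc]
            rw [h3, hyi, hiu, hyu]
          rw [this, pow_succ]
          exact Submodule.mul_mem_mul (ih _ (mul_mem_rad_right ha _))
            (mul_mem_rad_right (mul_mem_rad_left (mul_mem_rad_left hb _) _) _)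
        | add x _ y _ hx hy =>
          rw [mul_add, add_mul]
          exact add_mem hx hy
      have h1 := hsq _ (hi x hx)
      rwa [← mul_assoc, ← mul_assoc, he.mul_self, mul_assoc, he.mul_self] at h1
  obtain ⟨t, ht⟩ := exists_rad_pow_eq_bot k A
  have := key t x hx
  rwa [pow_succ, ht, Submodule.bot_mul, Submodule.mem_bot] at this

/-- A nonzero value would give `eᵢA ≅ eⱼA`, and with it a nonzero radical endomorphism of `eᵢA`. -/
theorem SincereRigidFaithful.mul_rad_mul_eq_zero (hA : SincereRigidFaithful A)
    (he : IsCompletePrimitive e) {i j : Fin n}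
    (hi : ∀ x ∈ rad k A, e i * x * e i ∈ rad k A * rad k A)
    (hl : loewy k (e i) ≤ loewy k (e j)) {x : A} (hx : x ∈ rad k A) : e i * x * e j = 0 := by
  by_contra hne
  obtain ⟨u, y, -, hyi, -, hyu⟩ := hA.exists_inverse (k := k) he ⟨x, hne⟩ hl
  have := hA.mul_rad_mul_self_eq_zero he hi (mul_mem_rad_right hx y)
  rw [← mul_assoc, mul_assoc, hyi] at this
  rw [← hyu, ← mul_assoc, this, zero_mul] at hne
  exact hne rfl

theorem submodulesProjective_of_forall_mul {ι : Type*} [Finite ι] {A : Type u} [Ring A] {c : ι → A}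
    (h : ∀ i, SubmodulesProjective Aᵐᵒᵖ (rightIdeal (c i))) (P : Submodule Aᵐᵒᵖ A)
    (hP : ∀ x ∈ P, (∀ i, c i * x = 0) → x = 0) : SubmodulesProjective Aᵐᵒᵖ P := by
  refine (SubmodulesProjective.pi_of_finite h).of_injective
    (LinearMap.pi fun i => (leftMul (c i)).rangeRestrict ∘ₗ P.subtype) ?_
  rw [← LinearMap.ker_eq_bot, LinearMap.ker_eq_bot']
  exact fun x hx => Subtype.ext (hP x x.2 fun i => congrArg Subtype.val (congrFun hx i))

theorem SincereRigidFaithful.submodulesProjective (hA : SincereRigidFaithful A)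
    (he : IsCompletePrimitive e) (hr : ∀ i, ∀ x ∈ rad k A, e i * x * e i ∈ rad k A * rad k A)
    (i : Fin n) : SubmodulesProjective Aᵐᵒᵖ (rightIdeal (e i)) := by
  classical
  induction hd : loewy k (e i) using Nat.strong_induction_on generalizing i with
  | _ d ih =>
  subst hd
  let S : Finset (Fin n) := {j | loewy k (e j) < loewy k (e i)}
  have hmem : ∀ j, j ∈ S ↔ loewy k (e j) < loewy k (e i) := fun s => by simp [S]
  let f := ∑ j ∈ S, e j
  have hf : IsIdempotentElem f := he.isIdempotentElem_sum S
  have hfA : SubmodulesProjective Aᵐᵒᵖ (rightIdeal f) := by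
    refine submodulesProjective_of_forall_mul (c := fun j : S => e j)
      (fun j => ih _ ((hmem j).1 j.2) j rfl) _ fun x hx h0 => ?_
    rw [← (mem_rightIdeal hf).1 hx, Finset.sum_mul]
    exact Finset.sum_eq_zero fun j hj => h0 ⟨j, hj⟩
  have : IsArtinian Aᵐᵒᵖ A := isArtinian_of_tower k inferInstance
  have hidem := (he.primitive i).idem
  intro N
  by_cases hN : ∃ x ∈ N, (x : A) ∉ rad k A
  · obtain ⟨x, hxN, hx⟩ := hN
    obtain ⟨b, hb⟩ := ((he.primitive i).mem_rad_or_exists_mul_eq (k := k)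
      ((mem_rightIdeal hidem).1 x.2)).resolve_left hx
    have hT : N = ⊤ := by
      refine eq_top_iff.2 fun y _ => ?_
      have : y = MulOpposite.op (b * y) • x := by
        refine Subtype.ext ?_
        change (y : A) = x * (b * y)
        rw [← mul_assoc, hb, (mem_rightIdeal hidem).1 y.2]
      rw [this]
      exact N.smul_mem _ hxN
    have := projective_rightIdeal hidem
    rw [hT]
    exact Module.Projective.of_equiv Submodule.topEquiv.symm
  · push Not at hN
    -- Radical elements of `eᵢA` have nonzero components only at vertices of smaller Loewy length.
    have hK : ∀ x : N, (x : A) ∈ idealGenerated f := by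
      intro x
      have hx : (x : A) = ∑ j, e i * x * e j := by
        rw [he.sum_mul', (mem_rightIdeal hidem).1 x.1.2]
      rw [hx]
      refine Submodule.sum_mem _ fun j _ => ?_
      by_cases hj : loewy k (e j) < loewy k (e i)
      · have : e i * x * e j = e i * x * e j * f * 1 := by
          rw [mul_one, mul_assoc _ _ f, he.mul_sum_eq ((hmem j).2 hj)]
        rw [this]
        exact mul_mul_mem_idealGenerated _ _ _
      · rw [hA.mul_rad_mul_eq_zero he (hr i) (not_lt.1 hj) (hN x x.2)]
        exact zero_mem _
    have hs : ∀ l, (∃ c, f * c * e l ≠ 0) ∨ e l ∉ idealGenerated f := by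
      intro l
      by_cases hl : ∃ c, f * c * e l ≠ 0
      · exact Or.inl hl
      refine Or.inr fun hlf => (he.primitive l).ne_zero ?_
      push Not at hl
      have key : ∀ x ∈ idealGenerated f, ∀ b, x * b * e l = 0 := by
        intro x hx
        induction hx using Submodule.span_induction with
        | mem x hx =>
          obtain ⟨a, rfl⟩ := hx
          intro b
          simp only
          rw [mul_assoc a, mul_assoc a, hl, mul_zero]
        | zero => simp
        | add x y _ _ hx hy =>
          intro b
          rw [add_mul, add_mul, hx, hy, add_zero]
        | smul r x _ hx =>
          intro b
          have := hx (r.unop * b)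
          rwa [← mul_assoc] at this
      simpa [he.mul_self] using key _ hlf 1
    -- Taking `h = f` in the cogeneration result embeds `N` in a finite power of `fA`.
    have hNP : SubmodulesProjective Aᵐᵒᵖ N := hfA.of_separating fun x hx => by
      obtain ⟨ψ, hψ⟩ := hA.exists_hom_ne_zero (k := k) he hf hf hs (hK x)
        fun h0 => hx (Subtype.ext (Subtype.ext h0))
      exact ⟨ψ ∘ₗ ((rightIdeal (e i)).subtype ∘ₗ N.subtype).codRestrict _ hK, hψ⟩
    have := hNP ⊤
    exact Module.Projective.of_equiv Submodule.topEquiv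

theorem SincereRigidFaithful.isHereditary (hA : SincereRigidFaithful A)
    (he : IsCompletePrimitive e) (hr : ∀ i, ∀ x ∈ rad k A, e i * x * e i ∈ rad k A * rad k A) :
    IsHereditary A := fun I => by
  have := submodulesProjective_of_forall_mul (hA.submodulesProjective he hr) I
    (fun x _ hx => by rw [← he.sum_mul x]; exact Finset.sum_eq_zero fun i _ => hx i) ⊤
  exact Module.Projective.of_equiv Submodule.topEquiv

end LoewyLength

/-! ### Consequences of heredity. -/

section Hereditary

variable {k : Type w} {A : Type u} [Field k] [Ring A] [Algebra k A] [FiniteDimensional k A]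

/-- Over a hereditary algebra, radical endomorphisms of an indecomposable projective vanish. -/
theorem IsHereditary.eq_zero_of_mem_rad (hA : IsHereditary A) {e : A}
    (he : IsPrimitiveIdempotent e) {x : A} (hx : x ∈ rad k A) (h1 : e * x = x) (h2 : x * e = x) :
    x = 0 := by
  have := hA (LinearMap.range (leftMul x))
  obtain ⟨s, hs⟩ := Module.projective_lifting_property (leftMul x).rangeRestrict LinearMap.id
    (leftMul x).surjective_rangeRestrict
  let g : A →ₗ[Aᵐᵒᵖ] A := s ∘ₗ (leftMul x).rangeRestrict
  have hxg : ∀ a, x * g a = x * a := fun a =>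
    congrArg Subtype.val (LinearMap.congr_fun hs ((leftMul x).rangeRestrict a))
  have hg : ∀ a b, x * a = x * b → g a = g b := fun a b h =>
    congrArg s (Subtype.ext (show leftMul x a = leftMul x b from h))
  have hg1 : ∀ a, g a = g 1 * a := fun a => by
    have := g.map_smul (MulOpposite.op a) 1
    rwa [op_smul_eq_mul, op_smul_eq_mul, one_mul] at this
  have hxy : x * g 1 = x := by rw [hxg, mul_one]
  have hye : g 1 * e = g 1 := by rw [← hg1, hg e 1 (by rw [h2, mul_one])]
  have hyy : g 1 * g 1 = g 1 := by rw [← hg1, hg _ 1 (by rw [hxg])]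
  have hff : e * g 1 * (e * g 1) = e * g 1 := by
    rw [mul_assoc, ← mul_assoc (g 1), hye, hyy]
  have hef : e * (e * g 1) = e * g 1 := by rw [← mul_assoc, he.idem.eq]
  have hfe : e * g 1 * e = e * g 1 := by rw [mul_assoc, hye]
  have hxf : x * (e * g 1) = x := by rw [← mul_assoc, h2, hxy]
  -- The splitting of `A → xA` yields an idempotent `e * g 1` of `eAe`: if it is `0` then `x = 0`;
  -- if it is `e` then `x` acts injectively on `eA`.
  obtain h | h := he.eq_zero_or_eq_zero (e * g 1) (e - e * g 1) hff (by
      change (e - e * g 1) * (e - e * g 1) = e - e * g 1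
      rw [mul_sub, sub_mul, sub_mul, he.idem.eq, hef, hfe, hff, sub_self, sub_zero])
    (by rw [mul_sub, hff, hfe, sub_self]) (by rw [sub_mul, hef, hff, sub_self]) (by abel)
  · rw [← hxf, h, mul_zero]
  · have hinj : ∀ a, e * a = a → x * a = 0 → a = 0 := by
      intro a ha hxa
      have h3 : g 1 * a = 0 := by rw [← hg1, hg a 0 (by rw [hxa, mul_zero]), map_zero]
      rw [← ha, sub_eq_zero.1 h, mul_assoc, h3, mul_zero]
    obtain ⟨t, ht⟩ := isNilpotent_of_mem_rad hx
    have hpow : ∀ t : ℕ, x ^ (t + 1) = 0 → x = 0 := by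
      intro t
      induction t with
      | zero => simp
      | succ t ih =>
        intro h0
        refine ih (hinj _ ?_ (by rw [← pow_succ', h0]))
        rw [pow_succ', ← mul_assoc, h1]
    exact hpow t (by rw [pow_succ, ht, zero_mul])

include k in
theorem IsHereditary.isFaithful (hA : IsHereditary A) {M : Type u} [AddCommGroup M]
    [Module Aᵐᵒᵖ M] [Module.Finite Aᵐᵒᵖ M] (hs : IsSincere A M) (hM : HasNoSelfExtensions A M) :
    IsFaithful A M := by
  classical
  have : IsArtinian Aᵐᵒᵖ A := isArtinian_of_tower k inferInstance
  have : IsNoetherian Aᵐᵒᵖ A := isNoetherian_of_tower k inferInstance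
  obtain ⟨t, ht⟩ := exists_finset_ker fun m : M => actOn (A := A) m
  obtain ⟨r, π, hπ⟩ := Module.Finite.exists_fin' Aᵐᵒᵖ M
  have hsub : SubmodulesProjective Aᵐᵒᵖ Aᵐᵒᵖ :=
    SubmodulesProjective.of_injective (M := Aᵐᵒᵖ) (N := A) hA
      (LinearMap.toSpanSingleton Aᵐᵒᵖ A 1) fun x y hxy => by
        simpa [MulOpposite.smul_eq_mul_unop] using hxy
  let Z := Fin r → Aᵐᵒᵖ
  have hZ : SubmodulesProjective Aᵐᵒᵖ (t → Z) :=
    SubmodulesProjective.pi_of_finite fun _ => SubmodulesProjective.pi_of_finite fun _ => hsub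
  let g : A →ₗ[Aᵐᵒᵖ] (t → M) := LinearMap.pi fun m => actOn m.1
  let π' : (t → Z) →ₗ[Aᵐᵒᵖ] (t → M) := LinearMap.pi fun m => π ∘ₗ LinearMap.proj m
  -- Heredity makes `W` projective. It covers `range g ≅ A/I` with kernel `(ker π)^t`, so rigidity
  -- of `M` applies one component at a time.
  let W := (LinearMap.range g).comap π'
  have := hZ W
  let ρ : W →ₗ[Aᵐᵒᵖ] LinearMap.range g := (π' ∘ₗ W.subtype).codRestrict _ fun w => w.2
  have hρ : Function.Surjective ρ := by
    rintro ⟨y, hy⟩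
    choose z hz using fun m => hπ (y m)
    have hzy : π' z = y := funext hz
    exact ⟨⟨z, by rw [Submodule.mem_comap, hzy]; exact hy⟩, Subtype.ext hzy⟩
  have hext : Subsingleton (Abelian.Ext (ModuleCat.of Aᵐᵒᵖ (LinearMap.range g))
      (ModuleCat.of Aᵐᵒᵖ M) 1) := by
    rw [subsingleton_ext_one_iff ρ hρ]
    intro θ
    have hsingle : ∀ (m : t) (z : LinearMap.ker π), π' (Pi.single m (z : Z)) = 0 := by
      intro m z
      ext m'
      by_cases h : m' = m
      · subst h
        simp [π']
      · simp [π', h]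
    let j (m : t) : LinearMap.ker π →ₗ[Aᵐᵒᵖ] LinearMap.ker ρ :=
      ((LinearMap.single Aᵐᵒᵖ (fun _ : t => Z) m ∘ₗ (LinearMap.ker π).subtype).codRestrict W
        fun z => by
          rw [Submodule.mem_comap]
          exact (hsingle m z).symm ▸ zero_mem _).codRestrict _
        fun z => Subtype.ext (hsingle m z)
    choose θ' hθ' using fun m => (subsingleton_ext_one_iff π hπ).1 hM (θ ∘ₗ j m)
    refine ⟨(∑ m, θ' m ∘ₗ LinearMap.proj m) ∘ₗ W.subtype, fun x => ?_⟩
    have hxk : ∀ m, (x : W).1 m ∈ LinearMap.ker π := fun m =>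
      congrFun (congrArg Subtype.val (LinearMap.mem_ker.1 x.2)) m
    have hx : x = ∑ m, j m ⟨(x : W).1 m, hxk m⟩ := by
      refine Subtype.ext (Subtype.ext ?_)
      rw [AddSubmonoidClass.coe_finsetSum, AddSubmonoidClass.coe_finsetSum]
      exact (Finset.univ_sum_single (x : W).1).symm
    conv_rhs => rw [hx, map_sum]
    rw [LinearMap.comp_apply, LinearMap.sum_apply]
    exact Finset.sum_congr rfl fun m _ => hθ' m ⟨(x : W).1 m, hxk m⟩
  rw [subsingleton_ext_one_iff g.rangeRestrict g.surjective_rangeRestrict] at hext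
  have := hA (LinearMap.ker g.rangeRestrict)
  intro a ha
  by_contra hne
  have haI : a ∈ LinearMap.ker g.rangeRestrict :=
    Subtype.ext (funext fun m => ha m)
  have : Nontrivial (LinearMap.ker g.rangeRestrict) :=
    ⟨⟨a, haI⟩, 0, fun h => hne (congrArg Subtype.val h)⟩
  obtain ⟨f, hf⟩ := hs (LinearMap.ker g.rangeRestrict)
  obtain ⟨f', hf'⟩ := hext f
  refine hf (LinearMap.ext fun x => ?_)
  have hx : ∀ m ∈ t, actOn (A := A) m x = 0 := fun m hm =>
    congrFun (congrArg Subtype.val (LinearMap.mem_ker.1 x.2)) ⟨m, hm⟩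
  -- The extension satisfies `f' x = f' 1 · x`, which is zero because `x` annihilates `M`.
  have h1 := f'.map_smul (MulOpposite.op (x : A)) 1
  rw [op_smul_eq_mul, one_mul, hf'] at h1
  rw [h1]
  exact ht x hx (f' 1)

theorem hasNoLoop_ordinaryQuiver_iff {n : ℕ} {e : Fin n → A} :
    HasNoLoop (ordinaryQuiver k e) ↔
      ∀ i, ∀ x ∈ rad k A, e i * x * e i ∈ rad k A * rad k A := by
  refine forall_congr' fun i => ?_
  change IsEmpty (Fin (Module.finrank k (arrowSpace k (e i) (e i)))) ↔ _
  rw [← not_nonempty_iff, ← Fin.pos_iff_nonempty, not_lt, Nat.le_zero, Submodule.finrank_eq_zero,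
    arrowSpace, ← Submodule.map_comp, ← LinearMap.le_ker_iff_map, LinearMap.ker_comp, Submodule.ker_mkQ]
  refine forall₂_congr fun x _ => ?_
  rw [mul_assoc]
  rfl

end Hereditary

end FDAlgebra

theorem proposition2p5 {k : Type w} {A : Type u} [Field k] [IsAlgClosed k] [Ring A] [Algebra k A]
    [FiniteDimensional k A] (hA : FDAlgebra.IsBasicAlgebra A)
    {n : ℕ} (e : Fin n → A) (he : FDAlgebra.IsCompletePrimitive e) :
    FDAlgebra.IsHereditary A ↔
      (FDAlgebra.HasNoLoop (FDAlgebra.ordinaryQuiver k e) ∧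
        ∀ (M : Type u) [AddCommGroup M] [Module Aᵐᵒᵖ M] [Module.Finite Aᵐᵒᵖ M],
          FDAlgebra.IsSincere A M → FDAlgebra.HasNoSelfExtensions A M →
            FDAlgebra.IsFaithful A M) := by
  rw [FDAlgebra.hasNoLoop_ordinaryQuiver_iff]
  refine ⟨fun h => ⟨fun i x hx => ?_, fun M _ _ _ hs hM => h.isFaithful (k := k) hs hM⟩,
    fun h => FDAlgebra.SincereRigidFaithful.isHereditary h.2 he h.1⟩
  rw [h.eq_zero_of_mem_rad (he.primitive i)
    (FDAlgebra.mul_mem_rad_right (FDAlgebra.mul_mem_rad_left hx (e i)) (e i))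
    (by rw [← mul_assoc, ← mul_assoc, he.mul_self]) (by rw [mul_assoc, he.mul_self])]
  exact zero_mem _
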